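/- **Disjoint Multicast Theorem (ADT networks).** An ADT network $G$ has a finite set $\mathcal V$ of supernodes; each $V\in\mathcal V$ has a finite set $I(V)$ of input ports and a finite set $O(V)$ of output ports, and $\mathcal E$ is a set of edges $(e,e')$ from output ports $e$ to input ports $e'$. Assume that $G$ is acyclic, i.e. the directed graph on $\mathcal V$ in which $V_1\to V_2$ whenever some edge goes from $O(V_1)$ to $I(V_2)$ has no directed cycle. Fix a finite field $\mathbb F_q$, a source $S\in\mathcal V$ with processes $X(S,1),\dots,X(S,\mu)$, a finite set $\mathcal T\subseteq\mathcal V\setminus\{S\}$ of destinations, and for each $T\in\mathcal T$ a set $\mathcal X(S,T)\subseteq\{X(S,1),\dots,X(S,\mu)\}$; assume that $\mathcal X(S,T)\cap\mathcal X(S,T')=\emptyset$ for all distinct $T,T'\in\mathcal T$. Given coefficients $\alpha_{(i,e)},\beta_{(e',e)},\epsilon_{(e',(T,k))}\in\mathbb F_q$, the symbols $Y$ at the ports are determined by $$Y(e')=\sum_{(e,e')\in\mathcal E}Y(e)\quad(e'\in I(V)),\qquad Y(e)=\sum_{e'\in I(V)}\beta_{(e',e)}Y(e')+[V=S]\sum_{i=1}^{\mu}\alpha_{(i,e)}X(S,i)\quad(e\in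 O(V)),$$ and a destination $T$ forms $Z(T,k)=\sum_{e'\in I(T)}\epsilon_{(e',(T,k))}Y(e')$. The problem $(G,\{(S,T,\mathcal X(S,T)):T\in\mathcal T\})$ is *solvable* over $\mathbb F_q$ if the coefficients can be chosen such that, for all values of the source processes in $\mathbb F_q$, $Z(T,k)=X(S,k)$ for every $T\in\mathcal T$ and every $X(S,k)\in\mathcal X(S,T)$. For $\mathcal T'\subseteq\mathcal T$ let $$\mathrm{mincut}(S,\mathcal T')=\min\{\operatorname{rank}_{\mathbb F_q}(G_\Omega):\ \Omega\subseteq\mathcal V,\ S\in\Omega,\ \Omega\cap\mathcal T'=\emptyset\},$$ where $G_\Omega$ is the $0$-$1$ incidence matrix of the edges from output ports of supernodes in $\Omega$ (rows) to input ports of supernodes not in $\Omega$ (columns). Then the problem is solvable over $\mathbb F_q$ if and only if $$\mathrm{mincut}(S,\mathcal T')\ \ge\ \sum_{T\in\mathcal T'}|\mathcal X(S,T)|\qquad\text{for every }\mathcal T'\subseteq\mathcal T.$$ -/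

import Mathlib

/-- A deterministic (ADT) wireless network with supernode set `V`, input ports `In` and
output ports `Out`.  The input ports of a supernode `v` are the ports `i` with `inNode i = v`, its
output ports are the ports `o` with `outNode o = v`, and `Edge o i` says that there is an edge
from the output port `o` to the input port `i`. -/
structure ADTNetwork (V In Out : Type*) where
  inNode : In → V
  outNode : Out → V
  Edge : Out → In → Prop

namespace ADTNetwork

variable {V In Out : Type*}

/-- Some edge goes from an output port of `u` to an input port of `v`. -/
def Link (N : ADTNetwork V In Out) (u v : V) : Prop :=
  ∃ o i, N.outNode o = u ∧ N.inNode i = v ∧ N.Edge o i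

/-- No directed cycle of supernodes.  As every input port of a supernode may feed every output port
of it, this is the same as having no directed cycle of ports. -/
def Acyclic (N : ADTNetwork V In Out) : Prop :=
  ∀ v, ¬ Relation.TransGen N.Link v v

open Classical in
/-- The incidence matrix `G_Ω` of the bipartite graph between the output ports of the supernodes in
`Ω` and the input ports of the supernodes outside `Ω`, with entries in `F`. -/
noncomputable def cutMatrix (N : ADTNetwork V In Out) (F : Type*) [Field F] (Ω : Set V) :
    Matrix {o : Out // N.outNode o ∈ Ω} {i : In // N.inNode i ∉ Ω} F :=
  Matrix.of fun o i => if N.Edge o.1 i.1 then 1 else 0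

open Classical in
/-- `mincut(S, T')`: the minimum of `rank G_Ω` over all `Ω` that contain `S` and no element of `T'`.
For `S ∉ T'` there is such an `Ω`, so that the infimum in `ℕ` is an attained minimum. -/
noncomputable def mincut [Fintype In] (N : ADTNetwork V In Out) (F : Type*) [Field F]
    (S : V) (T' : Finset V) : ℕ :=
  sInf {r : ℕ | ∃ Ω : Set V, S ∈ Ω ∧ (∀ t ∈ T', t ∉ Ω) ∧ r = (N.cutMatrix F Ω).rank}

/-- The coding coefficients of a linear code for a source with `m` processes: `α i e` of the source
process `i` at the output port `e`, `β e' e` from the input port `e'` to the output port `e`, and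
`ε e' t k` of the input port `e'` in the `k`-th decoded process of the supernode `t`.  Only
`α i e` with `e` at the source, `β e' e` with `e', e` at the same supernode, and `ε e' t k` with
`e'` at `t` are ever used. -/
structure Code (V In Out : Type*) (m : ℕ) (F : Type*) where
  α : Fin m → Out → F
  β : In → Out → F
  ε : In → V → Fin m → F

variable {m : ℕ} {F : Type*} [Field F]

open Classical in
/-- The symbols `yIn`, `yOut` at the ports are those carried by the network when the source `S`
emits `x` and the code `c` is used: an input port receives the sum of the symbols of all output
ports with an edge to it, an output port sends the prescribed linear combination of the symbols at
the input ports of its supernode, to which the source adds the prescribed linear combination of its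
own processes. -/
def IsTransmission [Fintype In] [Fintype Out] (N : ADTNetwork V In Out) (S : V)
    (c : Code V In Out m F) (x : Fin m → F) (yIn : In → F) (yOut : Out → F) : Prop :=
  (∀ e' : In, yIn e' = ∑ e : Out, if N.Edge e e' then yOut e else 0) ∧
  (∀ e : Out, yOut e =
    (∑ e' : In, if N.inNode e' = N.outNode e then c.β e' e * yIn e' else 0) +
      if N.outNode e = S then ∑ i : Fin m, c.α i e * x i else 0)

open Classical in
/-- The `k`-th process `Z(t, k)` that the supernode `t` forms from the symbols at its input ports. -/
noncomputable def decoded [Fintype In] (N : ADTNetwork V In Out) (c : Code V In Out m F)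
    (yIn : In → F) (t : V) (k : Fin m) : F :=
  ∑ e' : In, if N.inNode e' = t then c.ε e' t k * yIn e' else 0

/-- Solvability over `F` of the connections `(S, t, X t)`, `t ∈ T`: coding coefficients in `F` can
be chosen such that, whatever the source symbols `x` are, every destination `t` reproduces the
processes in `X t`.  In an acyclic network the port symbols are determined by `x` and the code. -/
def Solvable [Fintype In] [Fintype Out] (N : ADTNetwork V In Out) (F : Type*) [Field F] (S : V)
    (T : Finset V) (X : V → Finset (Fin m)) : Prop :=
  ∃ c : Code V In Out m F, ∀ x : Fin m → F, ∃ (yIn : In → F) (yOut : Out → F),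
    N.IsTransmission S c x yIn yOut ∧ ∀ t ∈ T, ∀ k ∈ X t, N.decoded c yIn t k = x k

end ADTNetwork

/-!
*Cut bound.* The successful transmissions of a code form a vector space that projects onto the
source symbols. In an acyclic network, a transmission for which zero crosses the cut `Ω` is zero at
every input port outside `Ω`, so that all processes demanded outside `Ω` are zero. Hence the rank of
`G_Ω` is at least the number of these processes.

*Achievability.* Consider signals `y` made of an unknown symbol at every output port and an unknown
message for every demanded process. Assign to every output port a functional, either `0` or an input
of its supernode (any functional at the source), which it shall send, and to every demanded process
such a functional at its destination, which shall recover the process. If only `y = 0` is consistent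
with the output ports and recovered as `0`, then sending `y` to its defects at the output ports
together with its recovered values is an injective, hence bijective, endomorphism, and its inverse
tells the source what to emit.

The functionals are found one at a time, under the invariant that for every set `W` of supernodes
the remaining `y` for which all supernodes outside `W` are silent form a space of dimension at most
the number of ports and demands at `W` not yet dealt with. Initially this is the cut condition. The
dimension is supermodular in `W` and the number is modular, so the sets attaining the bound are
closed under intersection; it is therefore enough that the new equation cuts down the space of the
least such set containing the supernode at hand. The invariant for that set without the supernode
shows that `0` or a single input does so. As nothing has to avoid several hyperplanes, no field is
too small.
-/

section SupportedSubspaces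

open Module

variable {V F M : Type*} [Field F] [AddCommGroup M] [Module F M]

/-- The elements of `L` that lie in `K v` for all `v ∉ W`. When `K v` consists of the vectors
vanishing at `v`, these are the elements of `L` supported on `W`. -/
def supportedOn (L : Submodule F M) (K : V → Submodule F M) (W : Set V) : Submodule F M :=
  L ⊓ ⨅ v ∈ Wᶜ, K v

variable {L : Submodule F M} {K : V → Submodule F M} {W W' : Set V}

theorem mem_supportedOn {y : M} : y ∈ supportedOn L K W ↔ y ∈ L ∧ ∀ v ∉ W, y ∈ K v := by
  simp [supportedOn]

theorem supportedOn_univ : supportedOn L K Set.univ = L := by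
  simp [supportedOn]

theorem supportedOn_mono (h : W ⊆ W') : supportedOn L K W ≤ supportedOn L K W' :=
  inf_le_inf_left L (biInf_mono fun _ hv hvW => hv (h hvW))

theorem supportedOn_inter :
    supportedOn L K (W ∩ W') = supportedOn L K W ⊓ supportedOn L K W' := by
  rw [supportedOn, Set.compl_inter, iInf_union, inf_inf_distrib_left]
  rfl

theorem finrank_supportedOn_add_finrank_supportedOn_le [FiniteDimensional F M] :
    finrank F (supportedOn L K W) + finrank F (supportedOn L K W') ≤
      finrank F (supportedOn L K (W ∪ W')) + finrank F (supportedOn L K (W ∩ W')) := by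
  rw [← Submodule.finrank_sup_add_finrank_inf_eq, supportedOn_inter]
  refine Nat.add_le_add_right (Submodule.finrank_mono ?_) _
  exact sup_le (supportedOn_mono Set.subset_union_left) (supportedOn_mono Set.subset_union_right)

theorem finrank_supportedOn_inter_eq_of_eq [FiniteDimensional F M] {d : Set V → ℕ}
    (hd : d (W ∪ W') + d (W ∩ W') = d W + d W')
    (hL : ∀ W, finrank F (supportedOn L K W) ≤ d W)
    (hW : finrank F (supportedOn L K W) = d W) (hW' : finrank F (supportedOn L K W') = d W') :
    finrank F (supportedOn L K (W ∩ W')) = d (W ∩ W') := by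
  have hsuper :=
    finrank_supportedOn_add_finrank_supportedOn_le (L := L) (K := K) (W := W) (W' := W')
  have hunion := hL (W ∪ W')
  have hinter := hL (W ∩ W')
  lia

theorem exists_supportedOn_le_of_finrank_eq [FiniteDimensional F M] {d : Set V → ℕ}
    (hd : ∀ W W', d (W ∪ W') + d (W ∩ W') = d W + d W')
    (hL : ∀ W, finrank F (supportedOn L K W) ≤ d W) {v : V}
    (hv : ∃ W, v ∈ W ∧ finrank F (supportedOn L K W) = d W) :
    ∃ W₀, v ∈ W₀ ∧ finrank F (supportedOn L K W₀) = d W₀ ∧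
      ∀ W, v ∈ W → finrank F (supportedOn L K W) = d W →
        supportedOn L K W₀ ≤ supportedOn L K W := by
  obtain ⟨W₀, ⟨hvW₀, hW₀⟩, hmin⟩ :=
    exists_minimalFor_of_wellFoundedLT _ (fun W => finrank F (supportedOn L K W)) hv
  refine ⟨W₀, hvW₀, hW₀, fun W hvW hW => ?_⟩
  have hinter := finrank_supportedOn_inter_eq_of_eq (hd W₀ W) hL hW₀ hW
  have heq : supportedOn L K (W₀ ∩ W) = supportedOn L K W₀ :=
    Submodule.eq_of_le_of_finrank_le (supportedOn_mono Set.inter_subset_left) <|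
      (le_total _ _).elim (hmin ⟨⟨hvW₀, hvW⟩, hinter⟩) id
  exact heq ▸ supportedOn_mono Set.inter_subset_right

end SupportedSubspaces

section Relays

open Module

variable {V Q F M : Type*} [Field F] [AddCommGroup M] [Module F M]

/-- The vectors for which the node `v` is silent: the functionals `A v` available at `v` vanish, and
so do the functionals `g q` for `q ∈ D` located at `v`, where `b q` is the location of `q`. Here `D`
stands for the outputs not yet matched with an available functional. -/
def silentAt (A : V → Set (Dual F M)) (g : Q → Dual F M) (b : Q → V) (D : Set Q) (v : V) :
    Submodule F M :=
  (⨅ f ∈ A v, LinearMap.ker f) ⊓ ⨅ q ∈ D ∩ b ⁻¹' {v}, LinearMap.ker (g q)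

variable {A : V → Set (Dual F M)} {g : Q → Dual F M} {b : Q → V} {D : Set Q} {L : Submodule F M}

theorem mem_silentAt {v : V} {y : M} :
    y ∈ silentAt A g b D v ↔ (∀ f ∈ A v, f y = 0) ∧ ∀ q ∈ D, b q = v → g q y = 0 := by
  simp [silentAt]

theorem supportedOn_inf_ker_le {q : Q} {f : Dual F M} (hf : f ∈ insert 0 (A (b q))) (W : Set V) :
    supportedOn (L ⊓ LinearMap.ker (g q - f)) (silentAt A g b D) W ≤
      supportedOn L (silentAt A g b (insert q D)) W ⊓ LinearMap.ker (g q - f) := by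
  intro y hy
  obtain ⟨⟨hyL, hyf⟩, hyW⟩ := mem_supportedOn.1 hy
  refine ⟨mem_supportedOn.2 ⟨hyL, fun v hv => ?_⟩, hyf⟩
  obtain ⟨hA, hD⟩ := mem_silentAt.1 (hyW v hv)
  refine mem_silentAt.2 ⟨hA, ?_⟩
  rintro q' (rfl | hq') rfl
  · have hfy : f y = 0 := by
      rcases hf with rfl | hf
      exacts [rfl, hA f hf]
    have hgy : g q' y - f y = 0 := hyf
    rwa [hfy, sub_zero] at hgy
  · exact hD q' hq' rfl

theorem finrank_le_finrank_add_ncard [FiniteDimensional F M] {s : Set Q} (hs : s.Finite)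
    (g : Q → Dual F M) {E E' : Submodule F M} (h : ∀ y ∈ E, (∀ q ∈ s, g q y = 0) → y ∈ E') :
    finrank F E ≤ finrank F E' + s.ncard := by
  have := hs.fintype
  let eval : E →ₗ[F] s → F := LinearMap.pi (fun q => g q) ∘ₗ E.subtype
  have hker : (LinearMap.ker eval).map E.subtype ≤ E' := by
    rintro _ ⟨y, hy, rfl⟩
    exact h y y.2 fun q hq => congrFun (LinearMap.mem_ker.1 hy) ⟨q, hq⟩
  calc finrank F E = finrank F (LinearMap.range eval) + finrank F (LinearMap.ker eval) :=
        eval.finrank_range_add_finrank_ker.symm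
    _ ≤ s.ncard + finrank F E' := by
        gcongr
        · exact (Submodule.finrank_le _).trans_eq
            (by rw [finrank_fintype_fun_eq_card, ← Nat.card_eq_fintype_card, Nat.card_coe_set_eq])
        · rw [(Submodule.equivMapOfInjective _ E.injective_subtype _).finrank_eq]
          exact Submodule.finrank_mono hker
    _ = _ := add_comm _ _

variable [FiniteDimensional F M] [Finite Q]

theorem exists_sub_apply_ne_zero {q : Q} (hq : q ∈ D) {W : Set V} (hqW : b q ∈ W)
    (hW : finrank F (supportedOn L (silentAt A g b D) W) = (D ∩ b ⁻¹' W).ncard)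
    (hL : finrank F (supportedOn L (silentAt A g b D) (W \ {b q})) ≤
      (D ∩ b ⁻¹' (W \ {b q})).ncard) :
    ∃ f ∈ insert 0 (A (b q)), ∃ y ∈ supportedOn L (silentAt A g b D) W, (g q - f) y ≠ 0 := by
  by_contra! hzero
  have hg : ∀ y ∈ supportedOn L (silentAt A g b D) W, g q y = 0 := fun y hy => by
    simpa using hzero 0 (Set.mem_insert _ _) y hy
  have hf : ∀ y ∈ supportedOn L (silentAt A g b D) W, ∀ f ∈ A (b q), f y = 0 := fun y hy f hf => by
    simpa [hg y hy] using hzero f (Set.mem_insert_of_mem _ hf) y hy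
  have hle : finrank F (supportedOn L (silentAt A g b D) W) ≤
      finrank F (supportedOn L (silentAt A g b D) (W \ {b q})) +
        ((D ∩ b ⁻¹' {b q}) \ {q}).ncard := by
    refine finrank_le_finrank_add_ncard (Set.toFinite _) g fun y hy hlocal => ?_
    refine mem_supportedOn.2 ⟨(mem_supportedOn.1 hy).1, fun v hv => ?_⟩
    by_cases hvq : v = b q
    · subst hvq
      refine mem_silentAt.2 ⟨hf y hy, fun q' hq' hbq' => ?_⟩
      obtain rfl | hne := eq_or_ne q' q
      exacts [hg y hy, hlocal q' ⟨⟨hq', hbq'⟩, hne⟩]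
    · exact (mem_supportedOn.1 hy).2 v fun hvW => hv ⟨hvW, hvq⟩
  have hsplit : (D ∩ b ⁻¹' W).ncard =
      (D ∩ b ⁻¹' (W \ {b q})).ncard + (D ∩ b ⁻¹' {b q}).ncard := by
    rw [← Set.ncard_union_eq (by grind), ← Set.inter_union_distrib_left, ← Set.preimage_union,
      Set.sdiff_union_of_subset (Set.singleton_subset_iff.2 hqW)]
  have hq_card := Set.ncard_sdiff_singleton_add_one (s := D ∩ b ⁻¹' {b q}) ⟨hq, rfl⟩
  lia

theorem ncard_inter_preimage_union_add_inter (W W' : Set V) :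
    (D ∩ b ⁻¹' (W ∪ W')).ncard + (D ∩ b ⁻¹' (W ∩ W')).ncard =
      (D ∩ b ⁻¹' W).ncard + (D ∩ b ⁻¹' W').ncard := by
  rw [Set.preimage_union, Set.preimage_inter, Set.inter_union_distrib_left,
    Set.inter_inter_distrib_left, Set.ncard_union_add_ncard_inter]

theorem exists_forall_sub_apply_ne_zero {q : Q} (hq : q ∈ D)
    (hL : ∀ W, finrank F (supportedOn L (silentAt A g b D) W) ≤ (D ∩ b ⁻¹' W).ncard) :
    ∃ f ∈ insert 0 (A (b q)), ∀ W, b q ∈ W →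
      finrank F (supportedOn L (silentAt A g b D) W) = (D ∩ b ⁻¹' W).ncard →
      ∃ y ∈ supportedOn L (silentAt A g b D) W, (g q - f) y ≠ 0 := by
  by_cases htight : ∃ W, b q ∈ W ∧
      finrank F (supportedOn L (silentAt A g b D) W) = (D ∩ b ⁻¹' W).ncard
  · obtain ⟨W₀, hqW₀, hW₀, hleast⟩ := exists_supportedOn_le_of_finrank_eq
      ncard_inter_preimage_union_add_inter hL htight
    obtain ⟨f, hf, y, hy, hne⟩ := exists_sub_apply_ne_zero hq hqW₀ hW₀ (hL _)
    exact ⟨f, hf, fun W hqW hW => ⟨y, hleast W hqW hW hy, hne⟩⟩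
  · exact ⟨0, Set.mem_insert _ _, fun W hqW hW => (htight ⟨W, hqW, hW⟩).elim⟩

theorem exists_finrank_supportedOn_inf_ker_le {q : Q} (hq : q ∉ D)
    (hL : ∀ W, finrank F (supportedOn L (silentAt A g b (insert q D)) W) ≤
      (insert q D ∩ b ⁻¹' W).ncard) :
    ∃ f ∈ insert 0 (A (b q)), ∀ W,
      finrank F (supportedOn (L ⊓ LinearMap.ker (g q - f)) (silentAt A g b D) W) ≤
        (D ∩ b ⁻¹' W).ncard := by
  obtain ⟨f, hf, hne⟩ := exists_forall_sub_apply_ne_zero (Set.mem_insert q D) hL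
  refine ⟨f, hf, fun W => (Submodule.finrank_mono (supportedOn_inf_ker_le hf W)).trans ?_⟩
  by_cases hqW : b q ∈ W
  · have hcard : (insert q D ∩ b ⁻¹' W).ncard = (D ∩ b ⁻¹' W).ncard + 1 := by
      rw [Set.insert_inter_of_mem (Set.mem_preimage.2 hqW),
        Set.ncard_insert_of_notMem fun h => hq h.1]
    rcases (hL W).lt_or_eq with hlt | htight
    · have hle := Submodule.finrank_mono (inf_le_left :
        supportedOn L (silentAt A g b (insert q D)) W ⊓ LinearMap.ker (g q - f) ≤ _)
      lia
    · obtain ⟨y, hy, hyf⟩ := hne W hqW htight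
      have hnot : ¬supportedOn L (silentAt A g b (insert q D)) W ≤ LinearMap.ker (g q - f) :=
        fun hle => hyf (hle hy)
      have hlt := Submodule.finrank_lt_finrank_of_lt (inf_lt_left.2 hnot)
      lia
  · rw [← Set.insert_inter_of_notMem (s := D) (a := q) (t := b ⁻¹' W) hqW]
    exact (Submodule.finrank_mono inf_le_left).trans (hL W)

theorem exists_relays_forall_eq_zero
    (hL : ∀ W, finrank F (supportedOn L (silentAt A g b D) W) ≤ (D ∩ b ⁻¹' W).ncard) :
    ∃ f : Q → Dual F M, (∀ q, f q ∈ insert 0 (A (b q))) ∧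
      ∀ y ∈ L, (∀ q ∈ D, g q y = f q y) → y = 0 := by
  classical
  induction D, Set.toFinite D using Set.Finite.induction_on generalizing L with
  | empty =>
    have hbot : L = ⊥ := by simpa [supportedOn_univ] using hL Set.univ
    exact ⟨0, fun q => Set.mem_insert _ _, fun y hy _ => (Submodule.mem_bot F).1 (hbot ▸ hy)⟩
  | @insert q D hq _ ih =>
    obtain ⟨φ, hφ, hcut⟩ := exists_finrank_supportedOn_inf_ker_le hq hL
    obtain ⟨f, hf, hinj⟩ := ih hcut
    refine ⟨Function.update f q φ, fun q' => ?_, fun y hy hgf => ?_⟩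
    · obtain rfl | hne := eq_or_ne q' q
      · simpa using hφ
      · simpa [hne] using hf q'
    · refine hinj y ⟨hy, ?_⟩ fun q' hq' => ?_
      · simpa [sub_eq_zero] using hgf q (Set.mem_insert q D)
      · simpa [ne_of_mem_of_not_mem hq' hq] using hgf q' (Set.mem_insert_of_mem q hq')

end Relays

namespace ADTNetwork

open Module

variable {V In Out : Type*} {m : ℕ} {F : Type*} [Field F]

open Classical in
theorem cutMatrix_transpose_mulVec_apply [Fintype Out] (N : ADTNetwork V In Out) {W : Set V}
    [Fintype {o // N.outNode o ∈ W}] {y : Out → F} (i : {i // N.inNode i ∉ W})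
    (hy : ∀ o, N.outNode o ∉ W → N.Edge o i → y o = 0) :
    ((N.cutMatrix F W).transpose.mulVec fun o => y o) i = ∑ o, if N.Edge o i then y o else 0 := by
  simp only [Matrix.mulVec, dotProduct, Matrix.transpose_apply, cutMatrix, Matrix.of_apply,
    ite_mul, one_mul, zero_mul]
  rw [← Finset.sum_subtype (Finset.univ.filter fun o => N.outNode o ∈ W) (by simp)
    (fun o => if N.Edge o i then y o else 0)]
  refine Finset.sum_subset (Finset.subset_univ _) fun o _ ho => ?_
  exact ite_eq_right_iff.2 (hy o (by simpa using ho))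

theorem finrank_ker_cutMatrix_transpose_add_rank (N : ADTNetwork V In Out) (W : Set V)
    [Fintype {o // N.outNode o ∈ W}] [Fintype {i // N.inNode i ∉ W}] :
    finrank F (LinearMap.ker (N.cutMatrix F W).transpose.mulVecLin) + (N.cutMatrix F W).rank =
      (N.outNode ⁻¹' W).ncard := by
  rw [← Matrix.rank_transpose, Matrix.rank, add_comm, LinearMap.finrank_range_add_finrank_ker,
    finrank_fintype_fun_eq_card, ← Nat.card_eq_fintype_card]
  exact Nat.card_coe_set_eq _

section Achievability

/-- Symbols at the output ports together with a message for every `r : R`. -/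
abbrev Signal (Out R F : Type*) : Type _ :=
  (Out → F) × (R → F)

variable {R : Type*}

theorem ncard_sumElim_preimage [Finite Out] [Finite R] (N : ADTNetwork V In Out) (τ : R → V)
    (W : Set V) :
    (Sum.elim N.outNode τ ⁻¹' W).ncard = (N.outNode ⁻¹' W).ncard + (τ ⁻¹' W).ncard := by
  rw [Set.preimage_sumElim, Set.ncard_union_eq (by grind),
    Set.ncard_image_of_injective _ Sum.inl_injective,
    Set.ncard_image_of_injective _ Sum.inr_injective]

theorem exists_signal_of_forall_eq_zero [Finite Out] [Finite R]
    {fOut : Out → Dual F (Signal Out R F)} {fR : R → Dual F (Signal Out R F)}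
    (hf : ∀ y : Signal Out R F, (∀ o, y.1 o = fOut o y) → (∀ r, fR r y = 0) → y = 0) :
    ∃ signal : (R → F) →ₗ[F] Signal Out R F, ∀ x,
      (∀ o, (signal x).1 o = fOut o (signal x)) ∧ ∀ r, fR r (signal x) = x r := by
  let Ψ : Signal Out R F →ₗ[F] Signal Out R F :=
    (LinearMap.fst F _ _ - LinearMap.pi fOut).prod (LinearMap.pi fR)
  have hΨ : Function.Injective Ψ := by
    refine (injective_iff_map_eq_zero Ψ).2 fun y hy => hf y (fun o => ?_) fun r => ?_
    · exact sub_eq_zero.1 (congrFun (congrArg Prod.fst hy) o)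
    · exact congrFun (congrArg Prod.snd hy) r
  let e := LinearEquiv.ofInjectiveEndo Ψ hΨ
  refine ⟨e.symm.toLinearMap ∘ₗ LinearMap.inr F _ _, fun x => ?_⟩
  have hx : Ψ (e.symm (0, x)) = (0, x) :=
    LinearMap.congr_fun (LinearEquiv.ofInjectiveEndo_right_inv Ψ hΨ) (0, x)
  exact ⟨fun o => sub_eq_zero.1 (congrFun (congrArg Prod.fst hx) o),
    fun r => congrFun (congrArg Prod.snd hx) r⟩

open Classical in
/-- The symbol at the input port `i`, as a functional of the signal. -/
noncomputable def received [Fintype Out] (N : ADTNetwork V In Out) (F R : Type*) [Field F]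
    (i : In) : Dual F (Signal Out R F) :=
  ∑ o, if N.Edge o i then LinearMap.proj o ∘ₗ LinearMap.fst F (Out → F) (R → F) else 0

/-- The functionals that `v` may use for its outputs: the symbols at its input ports and, if `v` is
the source, every functional, since the source may choose the whole signal. -/
def inputs [Fintype Out] (N : ADTNetwork V In Out) (F R : Type*) [Field F] (S v : V) :
    Set (Dual F (Signal Out R F)) :=
  N.received F R '' (N.inNode ⁻¹' {v}) ∪ {_f | v = S}

/-- The functionals to be matched with inputs: the symbol at an output port, and `0` for each
`r : R`, because a signal from which only zeros are recovered has to be trivial. -/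
def outputs (F : Type*) [Field F] : Out ⊕ R → Dual F (Signal Out R F) :=
  Sum.elim (fun o => LinearMap.proj o ∘ₗ LinearMap.fst F (Out → F) (R → F)) 0

variable [Fintype Out]

open Classical in
theorem received_apply (N : ADTNetwork V In Out) (i : In) (y : Signal Out R F) :
    N.received F R i y = ∑ o, if N.Edge o i then y.1 o else 0 := by
  simp [received, LinearMap.sum_apply, apply_ite (fun f : Dual F (Signal Out R F) => f y)]

/-- The signals sent by the output ports in `W` only and cancelling at the input ports outside
`W`. -/
def signalsWithin (N : ADTNetwork V In Out) (F R : Type*) [Field F] (W : Set V) :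
    Submodule F (Signal Out R F) where
  carrier := {y | (∀ i, N.inNode i ∉ W → N.received F R i y = 0) ∧
    ∀ o, N.outNode o ∉ W → y.1 o = 0}
  zero_mem' := by simp
  add_mem' := by simp +contextual
  smul_mem' := by simp +contextual

theorem supportedOn_silentAt_eq_bot (N : ADTNetwork V In Out) {S : V} (τ : R → V) {W : Set V}
    (hS : S ∉ W) :
    supportedOn ⊤ (silentAt (N.inputs F R S) (outputs F) (Sum.elim N.outNode τ) Set.univ) W = ⊥ :=
  (Submodule.eq_bot_iff _).2 fun y hy => (forall_dual_apply_eq_zero_iff F y).1 fun f =>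
    (mem_silentAt.1 ((mem_supportedOn.1 hy).2 S hS)).1 f (.inr rfl)

theorem supportedOn_silentAt_eq_signalsWithin (N : ADTNetwork V In Out) {S : V} (τ : R → V)
    {W : Set V} (hS : S ∈ W) :
    supportedOn ⊤ (silentAt (N.inputs F R S) (outputs F) (Sum.elim N.outNode τ) Set.univ) W =
      N.signalsWithin F R W := by
  ext y
  simp only [mem_supportedOn, mem_silentAt, Submodule.mem_top, true_and]
  constructor
  · intro h
    exact ⟨fun i hi => (h _ hi).1 _ (.inl ⟨i, rfl, rfl⟩),
      fun o ho => (h _ ho).2 (.inl o) trivial rfl⟩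
  · rintro ⟨hIn, hOut⟩ v hv
    constructor
    · rintro f (⟨i, rfl, rfl⟩ | rfl)
      exacts [hIn i hv, (hv hS).elim]
    · rintro (o | r) - rfl
      exacts [hOut o hv, rfl]

theorem finrank_signalsWithin_add_rank_le [Finite R] (N : ADTNetwork V In Out) (W : Set V)
    [Fintype {i // N.inNode i ∉ W}] :
    finrank F (N.signalsWithin F R W) + (N.cutMatrix F W).rank ≤
      (N.outNode ⁻¹' W).ncard + Nat.card R := by
  classical
  have := Fintype.ofFinite R
  let sent : Signal Out R F →ₗ[F] {o // N.outNode o ∈ W} → F :=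
    LinearMap.funLeft F F Subtype.val ∘ₗ LinearMap.fst F _ _
  let cut := (N.cutMatrix F W).transpose.mulVecLin
  have hcut : ∀ y : N.signalsWithin F R W, sent y ∈ LinearMap.ker cut := by
    rintro ⟨y, hIn, hOut⟩
    refine LinearMap.mem_ker.2 (funext fun i => ?_)
    refine (N.cutMatrix_transpose_mulVec_apply i fun o ho _ => hOut o ho).trans ?_
    rw [← received_apply, hIn i i.2, Pi.zero_apply]
  let sentAndMessages : N.signalsWithin F R W →ₗ[F] LinearMap.ker cut × (R → F) :=
    ((sent ∘ₗ Submodule.subtype _).codRestrict _ hcut).prod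
      (LinearMap.snd F _ _ ∘ₗ Submodule.subtype _)
  have hinj : Function.Injective sentAndMessages := by
    refine (injective_iff_map_eq_zero sentAndMessages).2 ?_
    rintro ⟨y, _, hOut⟩ hy
    obtain ⟨hsent, hmessages⟩ := Prod.ext_iff.1 hy
    refine Subtype.ext (Prod.ext (funext fun o => ?_) hmessages)
    by_cases ho : N.outNode o ∈ W
    exacts [congrFun (Subtype.ext_iff.1 hsent) ⟨o, ho⟩, hOut o ho]
  have hle := LinearMap.finrank_le_finrank_of_injective hinj
  rw [finrank_prod, finrank_fintype_fun_eq_card, ← Nat.card_eq_fintype_card] at hle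
  have hker : finrank F (LinearMap.ker cut) + (N.cutMatrix F W).rank = (N.outNode ⁻¹' W).ncard :=
    N.finrank_ker_cutMatrix_transpose_add_rank W
  lia

theorem finrank_supportedOn_silentAt_le [Finite R] (N : ADTNetwork V In Out) {S : V} {τ : R → V}
    {W : Set V} [Fintype {i // N.inNode i ∉ W}]
    (hW : S ∈ W → (τ ⁻¹' Wᶜ).ncard ≤ (N.cutMatrix F W).rank) :
    finrank F (supportedOn (⊤ : Submodule F (Signal Out R F))
        (silentAt (N.inputs F R S) (outputs F) (Sum.elim N.outNode τ) Set.univ) W) ≤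
      (Sum.elim N.outNode τ ⁻¹' W).ncard := by
  by_cases hS : S ∈ W
  · rw [N.supportedOn_silentAt_eq_signalsWithin τ hS, ncard_sumElim_preimage]
    have hrank := N.finrank_signalsWithin_add_rank_le (F := F) (R := R) W
    have hcompl := Set.ncard_add_ncard_compl (τ ⁻¹' W)
    have hdemand := hW hS
    rw [Set.preimage_compl] at hdemand
    lia
  · rw [N.supportedOn_silentAt_eq_bot τ hS, finrank_bot]
    exact Nat.zero_le _

open Classical in
theorem exists_coeff_of_mem_inputs [Fintype In] (N : ADTNetwork V In Out) {S v : V}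
    {f : Dual F (Signal Out R F)} (hf : f ∈ insert 0 (N.inputs F R S v)) :
    ∃ (β : In → F) (φ : Dual F (Signal Out R F)), ∀ y, f y =
      (∑ i, if N.inNode i = v then β i * N.received F R i y else 0) + if v = S then φ y else 0 := by
  rcases hf with rfl | ⟨i, rfl, rfl⟩ | rfl
  · exact ⟨0, 0, by simp⟩
  · refine ⟨Pi.single i 1, 0, fun y => ?_⟩
    rw [Finset.sum_eq_single i (fun j _ hj => by simp [hj]) (by simp)]
    simp
  · exact ⟨0, f, by simp⟩

open Classical in
theorem exists_signal_of_ncard_le_rank_cutMatrix [Fintype In] [Finite R] (N : ADTNetwork V In Out)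
    {S : V} {τ : R → V} (hcut : ∀ W, S ∈ W → (τ ⁻¹' Wᶜ).ncard ≤ (N.cutMatrix F W).rank) :
    ∃ f : Out ⊕ R → Dual F (Signal Out R F),
      (∀ q, f q ∈ insert 0 (N.inputs F R S (Sum.elim N.outNode τ q))) ∧
      ∃ signal : (R → F) →ₗ[F] Signal Out R F, ∀ x,
        (∀ o, (signal x).1 o = f (.inl o) (signal x)) ∧ ∀ r, f (.inr r) (signal x) = x r := by
  obtain ⟨f, hf, hinj⟩ := exists_relays_forall_eq_zero (L := ⊤) (A := N.inputs F R S)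
    (g := outputs F) (b := Sum.elim N.outNode τ) (D := Set.univ) fun W => by
      rw [Set.univ_inter]
      exact N.finrank_supportedOn_silentAt_le (hcut W)
  refine ⟨f, hf, exists_signal_of_forall_eq_zero fun y hOut hR => ?_⟩
  refine hinj y trivial ?_
  rintro (o | r) -
  exacts [hOut o, (hR r).symm]

open Classical in
theorem solvable_of_ncard_le_rank_cutMatrix [Fintype In] (N : ADTNetwork V In Out) {S : V}
    {T : Finset V} (hST : S ∉ T) {X : V → Finset (Fin m)}
    (hcut : ∀ W, S ∈ W →
      {r : T.sigma X | r.1.1 ∉ W}.ncard ≤ (N.cutMatrix F W).rank) :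
    N.Solvable F S T X := by
  obtain ⟨f, hf, signal, hsignal⟩ := N.exists_signal_of_ncard_le_rank_cutMatrix hcut
  choose β φ hf using fun q => N.exists_coeff_of_mem_inputs (hf q)
  let encode : (Fin m → F) →ₗ[F] Signal Out (T.sigma X) F :=
    signal ∘ₗ LinearMap.funLeft F F fun r => r.1.2
  let c : Code V In Out m F :=
    { α := fun k o => φ (.inl o) (encode fun j => if k = j then 1 else 0)
      β := fun i o => β (.inl o) i
      ε := fun i t k => if h : ⟨t, k⟩ ∈ T.sigma X then β (.inr ⟨_, h⟩) i else 0 }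
  refine ⟨c, fun x => ⟨fun i => N.received F _ i (encode x), (encode x).1,
    ⟨fun i => N.received_apply i _, fun o => ?_⟩, fun t ht k hk => ?_⟩⟩
  · have hφ := (φ (.inl o) ∘ₗ encode).pi_apply_eq_sum_univ x
    simp only [LinearMap.comp_apply, smul_eq_mul, mul_comm (x _)] at hφ
    refine ((hsignal _).1 o).trans ((hf _ _).trans ?_)
    rw [← hφ]
    rfl
  · have htk : ⟨t, k⟩ ∈ T.sigma X := Finset.mem_sigma.2 ⟨ht, hk⟩
    have hdecode := (hsignal fun r => x r.1.2).2 ⟨⟨t, k⟩, htk⟩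
    have ht_ne : Sum.elim N.outNode (fun r : T.sigma X => r.1.1) (.inr ⟨⟨t, k⟩, htk⟩) ≠ S :=
      fun h => hST (h ▸ ht)
    rw [hf, if_neg ht_ne, add_zero] at hdecode
    simp only [decoded, c, dif_pos htk]
    exact hdecode

open Classical in
theorem ncard_setOf_fst_notMem_sigma (T : Finset V) (X : V → Finset (Fin m)) (W : Set V) :
    {r : T.sigma X | r.1.1 ∉ W}.ncard = ∑ t ∈ T with t ∉ W, (X t).card := by
  rw [← Finset.card_sigma, ← Set.ncard_coe_finset,
    ← Set.ncard_image_of_injective _ Subtype.val_injective]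
  congr 1
  ext ⟨t, k⟩
  simp only [Set.mem_image, Set.mem_ofPred_eq, Subtype.exists, Finset.mem_sigma,
    exists_and_left, exists_prop, exists_eq_right_right, Finset.coe_sigma, Finset.coe_filter,
    Set.mem_sigma_iff, SetLike.mem_coe]
  grind

end Achievability

section Converse

theorem Acyclic.wellFounded_transGen_link [Finite In] {N : ADTNetwork V In Out} (hN : N.Acyclic) :
    WellFounded (InvImage (Relation.TransGen N.Link) N.inNode) := by
  have : Std.Irrefl (InvImage (Relation.TransGen N.Link) N.inNode) := ⟨fun i => hN (N.inNode i)⟩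
  have : IsTrans In (InvImage (Relation.TransGen N.Link) N.inNode) :=
    ⟨fun _ _ _ hij hjk => Relation.TransGen.trans hij hjk⟩
  exact Finite.wellFounded_of_trans_of_irrefl _

variable [Fintype In] {N : ADTNetwork V In Out} {S : V} {c : Code V In Out m F}

theorem decoded_add (yIn yIn' : In → F) (t : V) (k : Fin m) :
    N.decoded c (yIn + yIn') t k = N.decoded c yIn t k + N.decoded c yIn' t k := by
  simp only [decoded, Pi.add_apply, mul_add, ite_add_zero, Finset.sum_add_distrib]

theorem decoded_smul (a : F) (yIn : In → F) (t : V) (k : Fin m) :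
    N.decoded c (a • yIn) t k = a * N.decoded c yIn t k := by
  simp only [decoded, Pi.smul_apply, smul_eq_mul, Finset.mul_sum, mul_ite, mul_zero, mul_left_comm]

theorem decoded_eq_zero {yIn : In → F} {t : V} (hIn : ∀ i, N.inNode i = t → yIn i = 0)
    (k : Fin m) : N.decoded c yIn t k = 0 := by
  classical
  exact Finset.sum_eq_zero fun i _ => ite_eq_right_iff.2 fun hi => by rw [hIn i hi, mul_zero]

variable [Fintype Out]

theorem IsTransmission.yOut_eq_zero {x : Fin m → F} {yIn : In → F} {yOut : Out → F}
    (h : N.IsTransmission S c x yIn yOut) {o : Out} (hS : N.outNode o ≠ S)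
    (hIn : ∀ i, N.inNode i = N.outNode o → yIn i = 0) : yOut o = 0 := by
  classical
  rw [h.2 o, if_neg hS, add_zero]
  exact Finset.sum_eq_zero fun i _ => ite_eq_right_iff.2 fun hi => by rw [hIn i hi, mul_zero]

theorem IsTransmission.yIn_eq_zero_of_cutMatrix_mulVec_eq_zero (hN : N.Acyclic) {x : Fin m → F}
    {yIn : In → F} {yOut : Out → F} (h : N.IsTransmission S c x yIn yOut) {W : Set V}
    [Fintype {o // N.outNode o ∈ W}] (hS : S ∈ W)
    (hcut : ((N.cutMatrix F W).transpose.mulVec fun o => yOut o) = 0) (i : In)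
    (hi : N.inNode i ∉ W) : yIn i = 0 := by
  induction i using hN.wellFounded_transGen_link.induction with
  | _ i ih =>
  rw [h.1 i, ← N.cutMatrix_transpose_mulVec_apply ⟨i, hi⟩, hcut, Pi.zero_apply]
  intro o ho hoi
  refine h.yOut_eq_zero (fun hoS => ho (hoS ▸ hS)) fun j hj => ih j ?_ (hj ▸ ho)
  exact .single ⟨o, i, hj.symm, rfl, hoi⟩

theorem IsTransmission.add {x x' : Fin m → F} {yIn yIn' : In → F} {yOut yOut' : Out → F}
    (h : N.IsTransmission S c x yIn yOut) (h' : N.IsTransmission S c x' yIn' yOut') :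
    N.IsTransmission S c (x + x') (yIn + yIn') (yOut + yOut') := by
  refine ⟨fun i => ?_, fun o => ?_⟩
  · simp only [Pi.add_apply, h.1 i, h'.1 i, ← Finset.sum_add_distrib, ite_add_ite, add_zero]
  · simp only [Pi.add_apply, h.2 o, h'.2 o, mul_add, Finset.sum_add_distrib, ite_add_zero]
    exact add_add_add_comm _ _ _ _

theorem IsTransmission.smul {x : Fin m → F} {yIn : In → F} {yOut : Out → F} (a : F)
    (h : N.IsTransmission S c x yIn yOut) :
    N.IsTransmission S c (a • x) (a • yIn) (a • yOut) := by
  refine ⟨fun i => ?_, fun o => ?_⟩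
  · simp only [Pi.smul_apply, smul_eq_mul, h.1 i, Finset.mul_sum, mul_ite, mul_zero]
  · simp only [Pi.smul_apply, smul_eq_mul, h.2 o, mul_add, Finset.mul_sum, mul_ite, mul_zero,
      mul_left_comm a]

/-- The triples of source symbols, input port symbols and output port symbols that arise when the
code `c` is used and for which all demands are met. -/
def successfulTransmissions (N : ADTNetwork V In Out) (S : V) (c : Code V In Out m F)
    (T : Finset V) (X : V → Finset (Fin m)) :
    Submodule F ((Fin m → F) × (In → F) × (Out → F)) where
  carrier := {p | N.IsTransmission S c p.1 p.2.1 p.2.2 ∧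
    ∀ t ∈ T, ∀ k ∈ X t, N.decoded c p.2.1 t k = p.1 k}
  zero_mem' := by simp [IsTransmission, decoded]
  add_mem' h h' := ⟨h.1.add h'.1, fun t ht k hk =>
    (decoded_add _ _ t k).trans (congrArg₂ _ (h.2 t ht k hk) (h'.2 t ht k hk))⟩
  smul_mem' a _ h := ⟨h.1.smul a, fun t ht k hk =>
    (decoded_smul a _ t k).trans (congrArg _ (h.2 t ht k hk))⟩

theorem Solvable.mono {T T' : Finset V} {X : V → Finset (Fin m)} (h : N.Solvable F S T X)
    (hT : T' ⊆ T) : N.Solvable F S T' X := by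
  obtain ⟨c, hc⟩ := h
  refine ⟨c, fun x => ?_⟩
  obtain ⟨yIn, yOut, htr, hdec⟩ := hc x
  exact ⟨yIn, yOut, htr, fun t ht => hdec t (hT ht)⟩

theorem Solvable.card_biUnion_le_rank_cutMatrix [DecidableEq (Fin m)] {T : Finset V}
    {X : V → Finset (Fin m)} (h : N.Solvable F S T X) (hN : N.Acyclic) {W : Set V}
    [Fintype {i // N.inNode i ∉ W}] (hS : S ∈ W) (hW : ∀ t ∈ T, t ∉ W) :
    (T.biUnion X).card ≤ (N.cutMatrix F W).rank := by
  classical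
  obtain ⟨c, hc⟩ := h
  let P := N.successfulTransmissions S c T X
  let demanded : P →ₗ[F] T.biUnion X → F :=
    LinearMap.funLeft F F Subtype.val ∘ₗ LinearMap.fst F _ _ ∘ₗ P.subtype
  let crossing : P →ₗ[F] {i // N.inNode i ∉ W} → F :=
    (N.cutMatrix F W).transpose.mulVecLin ∘ₗ LinearMap.funLeft F F Subtype.val ∘ₗ
      LinearMap.snd F _ _ ∘ₗ LinearMap.snd F _ _ ∘ₗ P.subtype
  have hsurj : Function.Surjective demanded := fun a => by
    obtain ⟨x, rfl⟩ := LinearMap.funLeft_surjective_of_injective F F Subtype.val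
      Subtype.val_injective a
    obtain ⟨yIn, yOut, htr, hdec⟩ := hc x
    exact ⟨⟨(x, yIn, yOut), htr, hdec⟩, rfl⟩
  have hker : LinearMap.ker crossing ≤ LinearMap.ker demanded := by
    rintro ⟨⟨x, yIn, yOut⟩, htr, hdec⟩ hcut
    refine funext fun ⟨k, hk⟩ => ?_
    obtain ⟨t, ht, hkt⟩ := Finset.mem_biUnion.1 hk
    refine (hdec t ht k hkt).symm.trans (decoded_eq_zero (fun i hi => ?_) k)
    exact htr.yIn_eq_zero_of_cutMatrix_mulVec_eq_zero hN hS hcut i (hi ▸ hW t ht)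
  have hdim := (LinearMap.finrank_range_add_finrank_ker crossing).trans
    (LinearMap.finrank_range_add_finrank_ker demanded).symm
  have hcard : finrank F (LinearMap.range demanded) = (T.biUnion X).card := by
    rw [LinearMap.range_eq_top.2 hsurj, finrank_top, finrank_fintype_fun_eq_card, Fintype.card_coe]
  have hrank : finrank F (LinearMap.range crossing) ≤ (N.cutMatrix F W).rank := by
    rw [← Matrix.rank_transpose]
    exact Submodule.finrank_mono (LinearMap.range_comp_le_range _ _)
  have hmono := Submodule.finrank_mono hker
  lia

end Converse

end ADTNetwork

theorem mainTheorem6_general {V In Out : Type*} [Fintype In] [Fintype Out]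
    (N : ADTNetwork V In Out) (hN : N.Acyclic) (F : Type*) [Field F] (m : ℕ) (S : V)
    (T : Finset V) (hST : S ∉ T) (X : V → Finset (Fin m))
    (hX : ∀ t ∈ T, ∀ t' ∈ T, t ≠ t' → Disjoint (X t) (X t')) :
    N.Solvable F S T X ↔
      ∀ T' : Finset V, T' ⊆ T → ∑ t ∈ T', (X t).card ≤ N.mincut F S T' := by
  classical
  constructor
  · intro h T' hT'
    rw [← Finset.card_biUnion fun t ht t' ht' => hX t (hT' ht) t' (hT' ht')]
    refine le_csInf ⟨_, {S}, rfl, fun t ht hS => hST (hS ▸ hT' ht), rfl⟩ ?_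
    rintro r ⟨Ω, hS, hΩ, rfl⟩
    exact (h.mono hT').card_biUnion_le_rank_cutMatrix hN hS hΩ
  · intro h
    refine N.solvable_of_ncard_le_rank_cutMatrix hST fun Ω hS => ?_
    rw [ADTNetwork.ncard_setOf_fst_notMem_sigma]
    refine (h _ (Finset.filter_subset _ T)).trans (Nat.sInf_le ⟨Ω, hS, fun t ht => ?_, rfl⟩)
    exact (Finset.mem_filter.1 ht).2

theorem mainTheorem6 {V In Out : Type*} [Fintype V] [Fintype In] [Fintype Out]
    (N : ADTNetwork V In Out) (hN : N.Acyclic)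
    (F : Type*) [Field F] [Finite F]
    (m : ℕ) (S : V) (T : Finset V) (hST : S ∉ T) (X : V → Finset (Fin m))
    (hX : ∀ t ∈ T, ∀ t' ∈ T, t ≠ t' → Disjoint (X t) (X t')) :
    N.Solvable F S T X ↔
      ∀ T' : Finset V, T' ⊆ T → ∑ t ∈ T', (X t).card ≤ N.mincut F S T' :=
  mainTheorem6_general N hN F m S T hST X hX
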